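/- Let $k$ be an algebraically closed field. A $k$-linear category is called *finite* if it is equivalent, as a $k$-linear category, to the category of finite-dimensional modules over some finite-dimensional $k$-algebra. Let $\mathcal A$ be a finite tensor category over $k$, i.e. a finite $k$-linear category with a rigid monoidal structure whose tensor product is $k$-bilinear on morphisms and whose unit satisfies $\mathrm{Hom}_{\mathcal A}(\mathbf 1,\mathbf 1)\cong k$. Right duals $c^\vee$ come with morphisms $c^\vee\otimes c\to\mathbf 1$ and $\mathbf 1\to c\otimes c^\vee$, left duals ${}^\vee c$ with morphisms $c\otimes{}^\vee c\to\mathbf 1$ and $\mathbf 1\to{}^\vee c\otimes c$. Let $\mathcal M$ be a left $\mathcal A$-module category, i.e. a finite $k$-linear category with a $k$-bilinear functor $\mathcal A\times\mathcal M\to\mathcal M$, $(a,m)\mapsto a.m$, exact in the first variable, together with coherent natural isomorphisms $(a\otimes b).m\cong a.(b.m)$ and $\mathbf 1.m\cong m$. Then $\mathcal M$ has an inner Hom, i.e. a functor $\underline{\mathrm{Hom}}(-,-)\colon\mathcal M^{\mathrm{op}}\times\mathcal M\to\mathcal A$ together with bijections $\mathrm{Hom}_{\mathcal A}(a,\underline{\mathrm{Hom}}(m,n))\cong\mathrm{Hom}_{\mathcal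 M}(a.m,n)$ natural in $a\in\mathcal A$ and $m,n\in\mathcal M$. Moreover, for every such inner Hom the following are equivalent: 1. $\mathcal M$ has both a left and a right relative Serre functor, that is, there are $k$-linear endofunctors $S^l$ and $S^r$ of $\mathcal M$ together with isomorphisms ${}^\vee\underline{\mathrm{Hom}}(m,n)\cong\underline{\mathrm{Hom}}(S^l(n),m)$ and $\underline{\mathrm{Hom}}(m,n)^\vee\cong\underline{\mathrm{Hom}}(n,S^r(m))$, natural in $m,n\in\mathcal M$. 2. $\mathcal M$ is an exact module category, that is, $p.m$ is projective for every projective $p\in\mathcal A$ and every $m\in\mathcal M$. -/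

import Mathlib

open CategoryTheory MonoidalCategory Limits Opposite
open MonoidalLeftAction

universe w v₁ v₂ u₁ u₂

namespace RelSerre

/-- A finite `k`-linear category: one that admits a `k`-linear equivalence to the category of
finite-dimensional modules over some finite-dimensional unital associative `k`-algebra `R`.
(Over such an `R`, finite-dimensional modules and finitely generated modules are the same.) -/
class IsFiniteLinearCategory (k : Type w) [Field k] (C : Type u₁) [Category.{v₁} C]
    [Preadditive C] [Linear k C] : Prop where
  exists_equivalence : ∃ (R : Type w) (_ : Ring R) (_ : Algebra k R) (_ : Module.Finite k R)
    (e : C ≌ FGModuleCat.{w} R), e.functor.Additive ∧ e.functor.Linear k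

/-- A finite tensor category over `k`: a finite `k`-linear category with a monoidal structure whose
tensor product is `k`-bilinear on morphisms, such that every object has both duals (this is the
class argument `RigidCategory`), and such that the endomorphism space of the unit is `k`. -/
class IsFiniteTensorCategory (k : Type w) [Field k] (A : Type u₁) [Category.{v₁} A]
    [Preadditive A] [Linear k A] [MonoidalCategory A] [RigidCategory A] : Prop
    extends IsFiniteLinearCategory k A, MonoidalPreadditive A, MonoidalLinear k A where
  hom_unit_unit : Nonempty ((𝟙_ A ⟶ 𝟙_ A) ≃ₗ[k] k)

/-- A (left) module category over `A`: a finite `k`-linear category `M` with an action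
`(a, m) ↦ a ⊙ₗ m` of the monoidal category `A` (including the coherent associativity and unit
isomorphisms) that is `k`-bilinear on morphisms and exact in the first variable. -/
class IsModuleCategory (k : Type w) [Field k] (A : Type u₁) [Category.{v₁} A]
    [Preadditive A] [Linear k A] [MonoidalCategory A]
    (M : Type u₂) [Category.{v₂} M] [Preadditive M] [Linear k M] [MonoidalLeftAction A M] : Prop
    extends IsFiniteLinearCategory k M where
  actionLeft_additive (a : A) : (actionLeft M a).Additive
  actionLeft_linear (a : A) : (actionLeft M a).Linear k
  actionRight_additive (m : M) : (actionRight A m).Additive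
  actionRight_linear (m : M) : (actionRight A m).Linear k
  actionRight_preservesFiniteLimits (m : M) : PreservesFiniteLimits (actionRight A m)
  actionRight_preservesFiniteColimits (m : M) : PreservesFiniteColimits (actionRight A m)

/-- An `A`-module category `M` is exact if `p ⊙ₗ m` is projective for every projective `p` in `A`
and every `m` in `M`. -/
def IsExactModuleCategory (A : Type u₁) [Category.{v₁} A] [MonoidalCategory A]
    (M : Type u₂) [Category.{v₂} M] [MonoidalLeftAction A M] : Prop :=
  ∀ (p : A) (m : M), Projective p → Projective (p ⊙ₗ m)

/-- An inner Hom of an `A`-module category `M`: a functor `Mᵒᵖ × M → A` (in curried form)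
together with bijections `(a ⊙ₗ m ⟶ n) ≃ (a ⟶ IHom(m, n))` natural in `a`, `m` and `n`. -/
structure InnerHom (A : Type u₁) [Category.{v₁} A] [MonoidalCategory A]
    (M : Type u₂) [Category.{v₂} M] [MonoidalLeftAction A M] where
  functor : Mᵒᵖ ⥤ M ⥤ A
  adj₂ : (curriedAction A M).flip ⊣₂ functor

namespace InnerHom

variable {A : Type u₁} [Category.{v₁} A] [MonoidalCategory A]
  {M : Type u₂} [Category.{v₂} M] [MonoidalLeftAction A M] (H : InnerHom A M)

/-- The inner Hom object `IHom(m, n)`. -/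
abbrev obj (m n : M) : A := (H.functor.obj (op m)).obj n

/-- The morphism `IHom(m', n) ⟶ IHom(m, n)` induced by `f : m ⟶ m'`. -/
abbrev mapLeft {m m' : M} (f : m ⟶ m') (n : M) : H.obj m' n ⟶ H.obj m n :=
  (H.functor.map f.op).app n

/-- The morphism `IHom(m, n) ⟶ IHom(m, n')` induced by `g : n ⟶ n'`. -/
abbrev mapRight (m : M) {n n' : M} (g : n ⟶ n') : H.obj m n ⟶ H.obj m n' :=
  (H.functor.obj (op m)).map g

end InnerHom

section

variable (k : Type w) [Field k] {A : Type u₁} [Category.{v₁} A] [MonoidalCategory A]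
  [RigidCategory A] {M : Type u₂} [Category.{v₂} M] [Preadditive M] [Linear k M]
  [MonoidalLeftAction A M]

/-- A right relative Serre functor: a `k`-linear endofunctor `S` of `M` with isomorphisms
`IHom(m, n)^∨ ≅ IHom(n, S m)` natural in `m` and `n`. The right dual `X^∨` comes with morphisms
`X^∨ ⊗ X ⟶ 𝟙` and `𝟙 ⟶ X ⊗ X^∨`. -/
structure RightRelativeSerreFunctor (H : InnerHom A M) where
  functor : M ⥤ M
  additive : functor.Additive
  linear : functor.Linear k
  iso (m n : M) : (HasRightDual.rightDual (H.obj m n) : A) ≅ H.obj n (functor.obj m)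
  naturality_left {m m' : M} (f : m ⟶ m') (n : M) :
    rightAdjointMate (H.mapLeft f n) ≫ (iso m' n).hom =
      (iso m n).hom ≫ H.mapRight n (functor.map f)
  naturality_right (m : M) {n n' : M} (g : n ⟶ n') :
    rightAdjointMate (H.mapRight m g) ≫ (iso m n).hom =
      (iso m n').hom ≫ H.mapLeft g (functor.obj m)

/-- A left relative Serre functor: a `k`-linear endofunctor `S` of `M` with isomorphisms
`^∨IHom(m, n) ≅ IHom(S n, m)` natural in `m` and `n`. The left dual `^∨X` comes with morphisms
`X ⊗ ^∨X ⟶ 𝟙` and `𝟙 ⟶ ^∨X ⊗ X`. -/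
structure LeftRelativeSerreFunctor (H : InnerHom A M) where
  functor : M ⥤ M
  additive : functor.Additive
  linear : functor.Linear k
  iso (m n : M) : (HasLeftDual.leftDual (H.obj m n) : A) ≅ H.obj (functor.obj n) m
  naturality_left {m m' : M} (f : m ⟶ m') (n : M) :
    leftAdjointMate (H.mapLeft f n) ≫ (iso m' n).hom =
      (iso m n).hom ≫ H.mapRight (functor.obj n) f
  naturality_right (m : M) {n n' : M} (g : n ⟶ n') :
    leftAdjointMate (H.mapRight m g) ≫ (iso m n).hom =
      (iso m n').hom ≫ H.mapLeft (functor.map g) m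

end

end RelSerre

/-!
The universal arrows of a right exact linear functor between finite linear categories exist: every
arrow `F a ⟶ d` factors through an arrow which kills no nonzero morphism into its source, the
sources of such effective arrows have bounded size because `Hom(P, a)` embeds into `Hom(F P, d)` for
a projective separator `P`, and an effective arrow of maximal size is universal. Hence such
functors are left adjoints (`isLeftAdjoint_of_rightExact`), and so are right exact contravariant
ones (`isLeftAdjoint_of_rightExact_op`, by means of an injective coseparator). Applied to the
functors `a ↦ a ⊙ₗ m` this gives the inner Hom.

Let `S` be a right relative Serre functor. Acting with an object of `A` preserves epimorphisms, so
`IHom(-, S m)` takes epimorphisms to monomorphisms. As `IHom(m, -)^∨` is isomorphic to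
`IHom(-, S m)`, the functor `IHom(m, -)` preserves epimorphisms, and `Hom(p ⊙ₗ m, -)`, which is
`Hom(p, IHom(m, -))`, preserves them as well if `p` is projective.

Conversely, let `M` be exact and test epimorphisms in `A` on a projective separator `P`. Since
`P ⊙ₗ m` is projective, `IHom(m, -)` preserves epimorphisms. For a monomorphism `j`, the
monomorphism `P ⊴ₗ j` has the projective cokernel `P ⊙ₗ coker j`, so it splits; therefore
`IHom(-, n)` takes monomorphisms to epimorphisms. Both functors are then exact and have right
adjoints; the values of these at the unit are objects `Sʳ m` and `Sˡ n` with
`Hom(n, Sʳ m) ≃ Hom(IHom(m, n), 𝟙)` and `Hom(Sˡ n, m) ≃ Hom(IHom(m, n), 𝟙)`. The isomorphisms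
`a ⊗ IHom(m, n) ≅ IHom(m, a ⊙ₗ n)` and `IHom(m, n) ⊗ a ≅ IHom(b ⊙ₗ m, n)`, for `a` a right dual of
`b`, upgrade these bijections to the statement that the composition pairings
`IHom(n, Sʳ m) ⊗ IHom(m, n) ⟶ 𝟙` and `IHom(m, n) ⊗ IHom(Sˡ n, m) ⟶ 𝟙` are duality pairings
(`nonempty_rightRelativeSerreFunctor`, `nonempty_leftRelativeSerreFunctor`).
-/

namespace RelSerre

/-! ### Finitely generated modules over a finite-dimensional algebra -/

namespace FGMod

variable {k : Type w} [Field k] {R : Type w} [Ring R] [Algebra k R]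

lemma isNoetherianRing (k : Type w) [Field k] (R : Type w) [Ring R] [Algebra k R]
    [Module.Finite k R] : IsNoetherianRing R :=
  isNoetherian_of_tower k inferInstance

lemma surjective_of_epi [IsNoetherianRing R] {X Y : FGModuleCat.{w} R} (f : X ⟶ Y) [Epi f] :
    Function.Surjective f.hom.hom := by
  have : Epi ((forget₂ (FGModuleCat R) (ModuleCat R)).map f) := inferInstance
  exact (ModuleCat.epi_iff_surjective _).1 this

lemma injective_of_mono [IsNoetherianRing R] {X Y : FGModuleCat.{w} R} (f : X ⟶ Y) [Mono f] :
    Function.Injective f.hom.hom := by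
  have : Mono ((forget₂ (FGModuleCat R) (ModuleCat R)).map f) := inferInstance
  exact (ModuleCat.mono_iff_injective _).1 this

lemma projective_self [IsNoetherianRing R] : Projective (FGModuleCat.of R R) where
  factors {E X} f e _ := by
    obtain ⟨g, hg⟩ := Module.projective_lifting_property e.hom.hom f.hom.hom (surjective_of_epi e)
    exact ⟨FGModuleCat.ofHom g, FGModuleCat.hom_ext hg⟩

lemma isSeparator_self : IsSeparator (FGModuleCat.of R R) := by
  rw [isSeparator_def]
  intro X Y f g h
  ext x
  have := h (FGModuleCat.ofHom (LinearMap.toSpanSingleton R X x))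
  have := congrArg (fun t => t.hom.hom (1 : R)) this
  change f.hom.hom ((1 : R) • x) = g.hom.hom ((1 : R) • x) at this
  simpa using this

variable (k R) in
/-- The `k`-linear dual of the right regular module of a `k`-algebra `R`, a left `R`-module through
`(r • f) x = f (x * r)`. -/
def DualReg : Type w := R →ₗ[k] k

namespace DualReg

noncomputable instance : AddCommGroup (DualReg k R) := inferInstanceAs (AddCommGroup (R →ₗ[k] k))

noncomputable instance : Module k (DualReg k R) := inferInstanceAs (Module k (R →ₗ[k] k))

instance : FunLike (DualReg k R) R k := inferInstanceAs (FunLike (R →ₗ[k] k) R k)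

@[ext] lemma ext {f g : DualReg k R} (h : ∀ x, f x = g x) : f = g := LinearMap.ext h

@[simp] lemma add_apply (f g : DualReg k R) (x : R) : (f + g) x = f x + g x := rfl

lemma map_add (f : DualReg k R) (x y : R) : f (x + y) = f x + f y := LinearMap.map_add f x y

@[simp] lemma map_zero (f : DualReg k R) : f 0 = 0 := LinearMap.map_zero f

@[simp] lemma smul_apply' (c : k) (f : DualReg k R) (x : R) : (c • f) x = c • f x := rfl

noncomputable instance : Module R (DualReg k R) where
  smul r f := (f : R →ₗ[k] k) ∘ₗ LinearMap.mulRight k r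
  one_smul f := ext fun x => congrArg f (mul_one x)
  mul_smul r s f := ext fun x => congrArg f (mul_assoc x r s).symm
  smul_zero _ := rfl
  smul_add _ _ _ := rfl
  add_smul r s f := ext fun x => (congrArg f (mul_add x r s)).trans (map_add f _ _)
  zero_smul f := ext fun x => (congrArg f (mul_zero x)).trans (map_zero f)

@[simp] lemma smul_apply (r : R) (f : DualReg k R) (x : R) : (r • f) x = f (x * r) := rfl

instance : IsScalarTower k R (DualReg k R) where
  smul_assoc c r f := ext fun x => by
    simp only [smul_apply, smul_apply', mul_smul_comm]
    exact LinearMap.map_smul f c (x * r)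

instance [Module.Finite k R] : Module.Finite R (DualReg k R) :=
  have : Module.Finite k (DualReg k R) := inferInstanceAs (Module.Finite k (R →ₗ[k] k))
  Module.Finite.of_restrictScalars_finite k R _

/-- A `k`-linear form `l` on an `R`-module as an `R`-linear map to `DualReg k R`, which takes `x` to
the form `r ↦ l (r • x)`. This inverts the bijection `g ↦ (x ↦ g x 1)`. -/
def lift {X : Type w} [AddCommGroup X] [Module k X] [Module R X] [IsScalarTower k R X]
    (l : X →ₗ[k] k) : X →ₗ[R] DualReg k R where
  toFun x := l ∘ₗ (LinearMap.toSpanSingleton R X x).restrictScalars k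
  map_add' x y := ext fun r => by
    change l (r • (x + y)) = l (r • x) + l (r • y)
    simp
  map_smul' s x := ext fun r => by
    change l (r • s • x) = l ((r * s) • x)
    rw [mul_smul]

end DualReg

variable [Module.Finite k R]

/-- Maps of `R`-modules into `DualReg k R` are linear forms over the field `k`, and these extend
along injections. -/
lemma injective_dualReg : Injective (FGModuleCat.of R (DualReg k R)) where
  factors {X Y} g f _ := by
    have := isNoetherianRing k R
    let _ : Module k X := Module.restrictScalars k R X
    let _ : Module k Y := Module.restrictScalars k R Y
    have : IsScalarTower k R X := IsScalarTower.restrictScalars k R X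
    have : IsScalarTower k R Y := IsScalarTower.restrictScalars k R Y
    let l : X →ₗ[k] k :=
      { toFun x := (g.hom.hom x : DualReg k R) 1
        map_add' x y := by simp
        map_smul' c x := by
          rw [← one_smul R x, ← smul_assoc, _root_.map_smul]
          have : ∀ z : DualReg k R, ((c • (1 : R)) • z) 1 = c • z 1 := fun z => by
            rw [smul_assoc, one_smul]; rfl
          rw [one_smul]
          exact this _ }
    obtain ⟨r, hr⟩ := LinearMap.exists_leftInverse_of_injective
      (f.hom.hom.restrictScalars k) (LinearMap.ker_eq_bot.2 (injective_of_mono f))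
    refine ⟨FGModuleCat.ofHom (DualReg.lift (l ∘ₗ r)), ?_⟩
    ext x s
    change l (r (s • f.hom.hom x)) = (g.hom.hom x : DualReg k R) s
    rw [← _root_.map_smul]
    have h := LinearMap.congr_fun hr (s • x)
    change r (f.hom.hom (s • x)) = s • x at h
    rw [h]
    change (g.hom.hom (s • x) : DualReg k R) 1 = _
    rw [_root_.map_smul]
    exact (DualReg.smul_apply (k := k) s _ 1).trans (by rw [one_mul])

lemma isCoseparator_dualReg : IsCoseparator (FGModuleCat.of R (DualReg k R)) := by
  rw [isCoseparator_def]
  intro X Y f g h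
  let _ : Module k Y := Module.restrictScalars k R Y
  have : IsScalarTower k R Y := IsScalarTower.restrictScalars k R Y
  ext x
  rw [← sub_eq_zero, ← Module.forall_dual_apply_eq_zero_iff k]
  intro l
  have := congrArg (fun t => (t.hom.hom x : DualReg k R) 1)
    (h (FGModuleCat.ofHom (DualReg.lift l)))
  change l ((1 : R) • f.hom.hom x) = l ((1 : R) • g.hom.hom x) at this
  simpa [sub_eq_zero] using this

lemma hom_finite (X Y : FGModuleCat.{w} R) : Module.Finite k (X ⟶ Y) := by
  let _ : Module k X := Module.restrictScalars k R X
  let _ : Module k Y := Module.restrictScalars k R Y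
  have : IsScalarTower k R X := IsScalarTower.restrictScalars k R X
  have : IsScalarTower k R Y := IsScalarTower.restrictScalars k R Y
  have : Module.Finite k X := Module.Finite.trans R X
  have : Module.Finite k Y := Module.Finite.trans R Y
  let Φ : (X ⟶ Y) →ₗ[k] (X →ₗ[k] Y) :=
    { toFun f := f.hom.hom.restrictScalars k
      map_add' _ _ := rfl
      map_smul' c f := by
        ext x
        rfl }
  refine Module.Finite.of_injective Φ fun f g h => ?_
  ext x
  exact LinearMap.congr_fun h x

end FGMod

/-! ### Finite linear categories -/

section FiniteLinear

lemma exists_abelian (k : Type w) [Field k] (C : Type u₁) [Category.{v₁} C]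
    [Preadditive C] [Linear k C] [IsFiniteLinearCategory k C] :
    ∃ i : Abelian C, i.toPreadditive = ‹Preadditive C› := by
  obtain ⟨R, _, _, _, e, he, -⟩ := IsFiniteLinearCategory.exists_equivalence (k := k) (C := C)
  have := FGMod.isNoetherianRing k R
  have : HasFiniteProducts C :=
    ⟨fun n => Adjunction.hasLimitsOfShape_of_equivalence e.functor⟩
  exact ⟨abelianOfEquivalence e.functor, rfl⟩

/-- A finite linear category is abelian, with its given preadditive structure. -/
noncomputable abbrev abelian (k : Type w) [Field k] (C : Type u₁) [Category.{v₁} C]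
    [Preadditive C] [Linear k C] [IsFiniteLinearCategory k C] : Abelian C :=
  have h := exists_abelian k C
  { toPreadditive := inferInstance
    normalMonoOfMono := by obtain ⟨i, rfl⟩ := h; exact i.normalMonoOfMono
    normalEpiOfEpi := by obtain ⟨i, rfl⟩ := h; exact i.normalEpiOfEpi
    has_finite_products := by obtain ⟨i, rfl⟩ := h; exact i.has_finite_products
    has_kernels := by obtain ⟨i, rfl⟩ := h; exact i.has_kernels
    has_cokernels := by obtain ⟨i, rfl⟩ := h; exact i.has_cokernels }

lemma exists_projective_separator (k : Type w) [Field k] (C : Type u₁) [Category.{v₁} C]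
    [Preadditive C] [Linear k C] [IsFiniteLinearCategory k C] :
    ∃ P : C, Projective P ∧ IsSeparator P := by
  obtain ⟨R, _, _, _, e, -, -⟩ := IsFiniteLinearCategory.exists_equivalence (k := k) (C := C)
  have := FGMod.isNoetherianRing k R
  exact ⟨e.symm.functor.obj (FGModuleCat.of R R),
    (e.symm.map_projective_iff _).2 FGMod.projective_self,
    FGMod.isSeparator_self.of_equivalence e.symm⟩

lemma exists_injective_coseparator (k : Type w) [Field k] (C : Type u₁) [Category.{v₁} C]
    [Preadditive C] [Linear k C] [IsFiniteLinearCategory k C] :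
    ∃ I : C, Injective I ∧ IsCoseparator I := by
  obtain ⟨R, _, _, _, e, -, -⟩ := IsFiniteLinearCategory.exists_equivalence (k := k) (C := C)
  exact ⟨e.symm.functor.obj (FGModuleCat.of R (FGMod.DualReg k R)),
    (e.symm.map_injective_iff _).2 FGMod.injective_dualReg,
    FGMod.isCoseparator_dualReg.of_equivalence e.symm⟩

lemma hom_finite (k : Type w) [Field k] {C : Type u₁} [Category.{v₁} C]
    [Preadditive C] [Linear k C] [IsFiniteLinearCategory k C]
    (X Y : C) : Module.Finite k (X ⟶ Y) := by
  obtain ⟨R, _, _, _, e, he, he'⟩ := IsFiniteLinearCategory.exists_equivalence (k := k) (C := C)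
  have := FGMod.hom_finite (k := k) (e.functor.obj X) (e.functor.obj Y)
  exact Module.Finite.of_injective (e.functor.mapLinearMap k (X := X) (Y := Y))
    e.functor.map_injective

end FiniteLinear

/-! ### Existence of right adjoints of right exact functors -/

section AdjointCriterion

variable {C : Type u₁} [Category.{v₁} C] {D : Type u₂} [Category.{v₂} D]

/-- A functor `F` is a left adjoint if every object `d` admits a universal arrow `F a ⟶ d`. -/
lemma isLeftAdjoint_of_exists_universal (F : C ⥤ D)
    (h : ∀ d, ∃ (a : C) (φ : F.obj a ⟶ d), ∀ (b : C) (ψ : F.obj b ⟶ d),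
      ∃! f : b ⟶ a, F.map f ≫ φ = ψ) : F.IsLeftAdjoint := by
  have : ∀ d, HasTerminal (CostructuredArrow F d) := fun d => by
    obtain ⟨a, φ, hφ⟩ := h d
    choose l hl hl' using fun b : CostructuredArrow F d => hφ b.left b.hom
    exact IsTerminal.hasTerminal (X := CostructuredArrow.mk φ)
      (IsTerminal.ofUniqueHom (fun b => CostructuredArrow.homMk (l b) (hl b))
        fun b m => CostructuredArrow.hom_ext _ _ (hl' b m.left (CostructuredArrow.w m)))
  exact isLeftAdjoint_of_costructuredArrowTerminals F

variable [Abelian C] [Preadditive D]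

/-- A morphism `φ : F a ⟶ d` is effective if no nonzero morphism into `a` is killed by `φ`. -/
def IsEffective (F : C ⥤ D) {a : C} {d : D} (φ : F.obj a ⟶ d) : Prop :=
  ∀ (b : C) (f : b ⟶ a), F.map f ≫ φ = 0 → f = 0

/-- A right exact functor on a category whose objects have finite size is a left adjoint as soon
as, for each `d`, the sources of effective morphisms `F a ⟶ d` have bounded size: each morphism
`F a ⟶ d` factors through an effective one on a quotient of `a`, and an effective morphism whose
source has the largest size is universal. -/
theorem isLeftAdjoint_of_bounded (F : C ⥤ D) [F.Additive] (s : C → ℕ)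
    (hmono : ∀ ⦃a c : C⦄ (f : a ⟶ c), Mono f → s c ≤ s a → IsIso f)
    (hcoker : ∀ ⦃b a : C⦄ (f : b ⟶ a), f ≠ 0 → s (cokernel f) < s a)
    (hexact : ∀ ⦃b a : C⦄ (d : D) (f : b ⟶ a) (φ : F.obj a ⟶ d), F.map f ≫ φ = 0 →
      ∃ φ' : F.obj (cokernel f) ⟶ d, F.map (cokernel.π f) ≫ φ' = φ)
    (hbound : ∀ d : D, ∃ N, ∀ (a : C) (φ : F.obj a ⟶ d), IsEffective F φ → s a ≤ N) :
    F.IsLeftAdjoint := by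
  refine isLeftAdjoint_of_exists_universal F fun d => ?_
  -- An arrow killing a nonzero `f` descends to the smaller object `cokernel f`.
  have quot : ∀ (n : ℕ) (a : C) (φ : F.obj a ⟶ d), s a = n → ∃ (c : C) (q : a ⟶ c)
      (φ' : F.obj c ⟶ d), F.map q ≫ φ' = φ ∧ IsEffective F φ' := by
    intro n
    induction n using Nat.strong_induction_on with
    | _ n ih =>
      intro a φ ha
      by_cases hφ : IsEffective F φ
      · exact ⟨a, 𝟙 a, φ, by simp, hφ⟩
      · simp only [IsEffective, not_forall] at hφ
        obtain ⟨b, f, hf, hf0⟩ := hφ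
        obtain ⟨φ₁, h₁⟩ := hexact d f φ hf
        obtain ⟨c, q, φ', hq, he⟩ := ih _ (ha ▸ hcoker f hf0) _ φ₁ rfl
        exact ⟨c, cokernel.π f ≫ q, φ', by rw [F.map_comp, Category.assoc, hq, h₁], he⟩
  obtain ⟨N, hN⟩ := hbound d
  obtain ⟨a, φ, hφ, hmax⟩ : ∃ (a : C) (φ : F.obj a ⟶ d), IsEffective F φ ∧
      ∀ (c : C) (ψ : F.obj c ⟶ d), IsEffective F ψ → s c ≤ s a := by
    let S : Set ℕ := {n | ∃ (a : C) (φ : F.obj a ⟶ d), IsEffective F φ ∧ s a = n}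
    have hS : S.Nonempty := by
      obtain ⟨z, -⟩ := HasZeroObject.zero (C := C)
      obtain ⟨c, -, φ', -, he⟩ := quot _ z (0 : F.obj z ⟶ d) rfl
      exact ⟨_, c, φ', he, rfl⟩
    have hb : BddAbove S := ⟨N, by rintro _ ⟨a, φ, h, rfl⟩; exact hN a φ h⟩
    obtain ⟨a, φ, h, ha⟩ := Nat.sSup_mem hS hb
    exact ⟨a, φ, h, fun c ψ hψ => ha ▸ le_csSup hb ⟨c, ψ, hψ, rfl⟩⟩
  refine ⟨a, φ, fun b ψ => ?_⟩
  -- Both arrows are restrictions of one effective arrow `χ : F c ⟶ d`. As `φ` is effective, `a ⟶ c`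
  -- is mono, hence an isomorphism by maximality of `a`.
  obtain ⟨c, q, χ, hq, hχ⟩ := quot _ (a ⊞ b) (F.map biprod.fst ≫ φ + F.map biprod.snd ≫ ψ) rfl
  have hl : F.map (biprod.inl ≫ q) ≫ χ = φ := by
    rw [F.map_comp, Category.assoc, hq]
    simp [← F.map_comp_assoc]
  have hr : F.map (biprod.inr ≫ q) ≫ χ = ψ := by
    rw [F.map_comp, Category.assoc, hq]
    simp [← F.map_comp_assoc]
  have : Mono (biprod.inl ≫ q) := Preadditive.mono_of_cancel_zero _ fun f hf => hφ _ f (by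
    rw [← hl, ← F.map_comp_assoc, hf, F.map_zero, zero_comp])
  have := hmono _ this (hmax c χ hχ)
  have hl' : F.map (inv (biprod.inl ≫ q)) ≫ φ = χ := by
    rw [← hl, ← F.map_comp_assoc, IsIso.inv_hom_id, F.map_id, Category.id_comp]
  refine ⟨biprod.inr ≫ q ≫ inv (biprod.inl ≫ q), ?_, fun f hf => ?_⟩
  · dsimp only
    rw [← Category.assoc, F.map_comp, Category.assoc, hl', hr]
  · refine sub_eq_zero.1 (hφ _ _ ?_)
    rw [F.map_sub, Preadditive.sub_comp, hf, ← Category.assoc, F.map_comp, Category.assoc, hl', hr,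
      sub_self]

/-- If `F` preserves finite colimits, then a morphism killed by `F f` factors through
`F (cokernel f)`. -/
lemma exists_factor_map_cokernel (F : C ⥤ D)
    [F.Additive] [PreservesFiniteColimits F] {b a : C} (d : D) (f : b ⟶ a) (φ : F.obj a ⟶ d)
    (h : F.map f ≫ φ = 0) : ∃ φ' : F.obj (cokernel f) ⟶ d, F.map (cokernel.π f) ≫ φ' = φ :=
  ⟨_, Cofork.IsColimit.π_desc' (isColimitOfHasCokernelOfPreservesColimit F f) φ (by simpa using h)⟩

end AdjointCriterion

section FiniteLinear

variable (k : Type w) [Field k] {C : Type u₁} [Category.{v₁} C] [Abelian C] [Linear k C]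
  [IsFiniteLinearCategory k C]

/-- The dimension of `Hom(P, -)`, for a separator `P`, grows strictly along proper monomorphisms. -/
lemma isIso_of_finrank_separator_le {P : C} (hP : IsSeparator P) {a c : C} (f : a ⟶ c) [Mono f]
    (h : Module.finrank k (P ⟶ c) ≤ Module.finrank k (P ⟶ a)) : IsIso f := by
  have := hom_finite k P a
  have := hom_finite k P c
  let Φ : (P ⟶ a) →ₗ[k] (P ⟶ c) := Linear.rightComp k P f
  have hΦ : Function.Injective Φ := fun x y hxy => (cancel_mono f).1 hxy
  have hs : Function.Surjective Φ :=
    (LinearMap.injective_iff_surjective_of_finrank_eq_finrank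
      (le_antisymm (LinearMap.finrank_le_finrank_of_injective hΦ) h)).1 hΦ
  have : Epi f := Preadditive.epi_of_cancel_zero _ fun g hg =>
    (Preadditive.isSeparator_iff P).1 hP g fun x => by
      obtain ⟨y, rfl⟩ := hs x
      change (y ≫ f) ≫ g = 0
      rw [Category.assoc, hg, comp_zero]
  exact isIso_of_mono_of_epi f

/-- The dimension of `Hom(P, -)`, for a projective separator `P`, drops strictly along proper
quotients. -/
lemma finrank_cokernel_lt {P : C} [Projective P] (hP : IsSeparator P) {b a : C} (f : b ⟶ a)
    (hf : f ≠ 0) : Module.finrank k (P ⟶ cokernel f) < Module.finrank k (P ⟶ a) := by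
  have := hom_finite k P a
  have := hom_finite k P (cokernel f)
  let Φ : (P ⟶ a) →ₗ[k] (P ⟶ cokernel f) := Linear.rightComp k P (cokernel.π f)
  have hs : Function.Surjective Φ := fun y => ⟨Projective.factorThru y (cokernel.π f), by
    change Projective.factorThru y (cokernel.π f) ≫ cokernel.π f = y; simp⟩
  refine lt_of_le_of_ne (LinearMap.finrank_le_finrank_of_surjective hs) fun h => hf ?_
  have hΦ := (LinearMap.injective_iff_surjective_of_finrank_eq_finrank h.symm).2 hs
  refine (Preadditive.isSeparator_iff P).1 hP f fun x => hΦ ?_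
  change (x ≫ f) ≫ cokernel.π f = 0 ≫ cokernel.π f
  simp

lemma isIso_of_finrank_coseparator_le {I : C} (hI : IsCoseparator I) {a c : C} (f : a ⟶ c) [Epi f]
    (h : Module.finrank k (a ⟶ I) ≤ Module.finrank k (c ⟶ I)) : IsIso f := by
  have := hom_finite k a I
  have := hom_finite k c I
  let Φ : (c ⟶ I) →ₗ[k] (a ⟶ I) := Linear.leftComp k I f
  have hΦ : Function.Injective Φ := fun x y hxy => (cancel_epi f).1 hxy
  have hs : Function.Surjective Φ :=
    (LinearMap.injective_iff_surjective_of_finrank_eq_finrank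
      (le_antisymm (LinearMap.finrank_le_finrank_of_injective hΦ) h)).1 hΦ
  have : Mono f := Preadditive.mono_of_cancel_zero _ fun g hg =>
    (Preadditive.isCoseparator_iff I).1 hI g fun x => by
      obtain ⟨y, rfl⟩ := hs x
      change g ≫ f ≫ y = 0
      rw [← Category.assoc, hg, zero_comp]
  exact isIso_of_mono_of_epi f

lemma finrank_kernel_lt {I : C} [Injective I] (hI : IsCoseparator I) {b a : C} (f : a ⟶ b)
    (hf : f ≠ 0) : Module.finrank k (kernel f ⟶ I) < Module.finrank k (a ⟶ I) := by
  have := hom_finite k a I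
  have := hom_finite k (kernel f) I
  let Φ : (a ⟶ I) →ₗ[k] (kernel f ⟶ I) := Linear.leftComp k I (kernel.ι f)
  have hs : Function.Surjective Φ := fun y => ⟨Injective.factorThru y (kernel.ι f), by
    change kernel.ι f ≫ Injective.factorThru y (kernel.ι f) = y; simp⟩
  refine lt_of_le_of_ne (LinearMap.finrank_le_finrank_of_surjective hs) fun h => hf ?_
  have hΦ := (LinearMap.injective_iff_surjective_of_finrank_eq_finrank h.symm).2 hs
  refine (Preadditive.isCoseparator_iff I).1 hI f fun x => hΦ ?_
  change kernel.ι f ≫ f ≫ x = kernel.ι f ≫ 0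
  simp

variable {D : Type u₂} [Category.{v₂} D] [Preadditive D] [Linear k D] [IsFiniteLinearCategory k D]

/-- A linear right exact functor between finite linear categories is a left adjoint: an effective
arrow `φ : F a ⟶ d` embeds `Hom(P, a)` into `Hom(F P, d)`, which bounds the size of `a`. -/
theorem isLeftAdjoint_of_rightExact (F : C ⥤ D) [F.Additive] [F.Linear k]
    [PreservesFiniteColimits F] : F.IsLeftAdjoint := by
  obtain ⟨P, _, hP⟩ := exists_projective_separator k C
  refine isLeftAdjoint_of_bounded F (fun a => Module.finrank k (P ⟶ a))
    (fun a c f _ h => isIso_of_finrank_separator_le k hP f h)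
    (fun b a f hf => finrank_cokernel_lt k hP f hf)
    (fun b a d f φ h => exists_factor_map_cokernel F d f φ h)
    fun d => ⟨Module.finrank k (F.obj P ⟶ d), fun a φ hφ => ?_⟩
  have := hom_finite k (F.obj P) d
  let Φ : (P ⟶ a) →ₗ[k] (F.obj P ⟶ d) := Linear.rightComp k (F.obj P) φ ∘ₗ F.mapLinearMap k
  exact LinearMap.finrank_le_finrank_of_injective (f := Φ)
    ((injective_iff_map_eq_zero Φ).2 fun x hx => hφ _ x hx)

/-- A linear contravariant functor between finite linear categories which is right exact, in the
sense that it takes kernels to cokernels, is a left adjoint. The size of `a` is the dimension of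
`Hom(a, I)` for an injective coseparator `I`. Linearity is spelled out since the opposite category
carries no `Linear` instance. -/
theorem isLeftAdjoint_of_rightExact_op (F : Cᵒᵖ ⥤ D) [F.Additive]
    (hF : ∀ ⦃a b : C⦄ (c : k) (f : a ⟶ b), F.map (c • f).op = c • F.map f.op)
    [PreservesFiniteColimits F] : F.IsLeftAdjoint := by
  obtain ⟨I, _, hI⟩ := exists_injective_coseparator k C
  refine isLeftAdjoint_of_bounded F (fun a => Module.finrank k (a.unop ⟶ I))
    (fun a c f _ h => ?_) (fun b a f hf => ?_)
    (fun b a d f φ h => exists_factor_map_cokernel F d f φ h)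
    fun d => ⟨Module.finrank k (F.obj (op I) ⟶ d), fun a φ hφ => ?_⟩
  · have := isIso_of_finrank_coseparator_le k hI f.unop h
    exact (isIso_unop_iff f).1 this
  · have e : (kernel f.unop ⟶ I) ≃ₗ[k] ((cokernel f).unop ⟶ I) :=
      Linear.homCongr k (kernelUnopUnop f) (Iso.refl I)
    rw [← e.finrank_eq]
    exact finrank_kernel_lt k hI f.unop fun h => hf (Quiver.Hom.unop_inj h)
  · have := hom_finite k (F.obj (op I)) d
    let Φ : (a.unop ⟶ I) →ₗ[k] (F.obj (op I) ⟶ d) :=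
      { toFun x := F.map x.op ≫ φ
        map_add' x y := by rw [op_add, F.map_add, Preadditive.add_comp]
        map_smul' c x := by rw [hF, Linear.smul_comp]; rfl }
    exact LinearMap.finrank_le_finrank_of_injective (f := Φ)
      ((injective_iff_map_eq_zero Φ).2 fun x hx => Quiver.Hom.op_inj (hφ _ x.op hx))

end FiniteLinear

/-! ### Acting with dual objects -/

section ActionCoherence

variable {A : Type u₁} [Category.{v₁} A] [MonoidalCategory A]
  {M : Type u₂} [Category.{v₂} M] [MonoidalLeftAction A M]

lemma associator_inv_action (a b c : A) (m : M) :
    (α_ a b c).inv ⊵ₗ m =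
      (αₗ a (b ⊗ c) m).hom ≫ a ⊴ₗ (αₗ b c m).hom ≫ (αₗ a b (c ⊙ₗ m)).inv ≫
        (αₗ (a ⊗ b) c m).inv := by
  rw [← cancel_epi ((α_ a b c).hom ⊵ₗ m), ← comp_actionHomLeft, Iso.hom_inv_id]
  simp

lemma associator_hom_action (a b c : A) (m : M) :
    (α_ a b c).hom ⊵ₗ m =
      (αₗ (a ⊗ b) c m).hom ≫ (αₗ a b (c ⊙ₗ m)).hom ≫ a ⊴ₗ (αₗ b c m).inv ≫
        (αₗ a (b ⊗ c) m).inv := by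
  rw [← cancel_mono ((α_ a b c).inv ⊵ₗ m), ← comp_actionHomLeft, Iso.hom_inv_id,
    associator_inv_action]
  simp

lemma leftUnitor_inv_action (a : A) (m : M) :
    (λ_ a).inv ⊵ₗ m = (λₗ (a ⊙ₗ m)).inv ≫ (αₗ (𝟙_ A) a m).inv := by
  rw [← cancel_epi ((λ_ a).hom ⊵ₗ m), ← comp_actionHomLeft, Iso.hom_inv_id]
  simp

lemma rightUnitor_inv_action (a : A) (m : M) :
    (ρ_ a).inv ⊵ₗ m = a ⊴ₗ (λₗ[A] m).inv ≫ (αₗ a (𝟙_ A) m).inv := by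
  rw [← cancel_epi ((ρ_ a).hom ⊵ₗ m), ← comp_actionHomLeft, Iso.hom_inv_id]
  simp

end ActionCoherence

section DualAction

variable {A : Type u₁} [Category.{v₁} A] [MonoidalCategory A]
  (M : Type u₂) [Category.{v₂} M] [MonoidalLeftAction A M] (X Y : A) [ExactPairing X Y]

variable {M} in
lemma coevaluation_evaluation_action (m : M) :
    Y ⊴ₗ (η_ X Y) ⊵ₗ m ≫ Y ⊴ₗ (αₗ X Y m).hom ≫ (αₗ Y X (Y ⊙ₗ m)).inv ≫ (ε_ X Y) ⊵ₗ (Y ⊙ₗ m) =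
      Y ⊴ₗ (λₗ m).hom ≫ (λₗ (Y ⊙ₗ m)).inv := by
  have h := congrArg (fun t => (αₗ _ _ m).inv ≫ t ⊵ₗ m ≫ (αₗ _ _ m).hom)
    (ExactPairing.coevaluation_evaluation X Y)
  simp only [comp_actionHomLeft, whiskerLeft_actionHomLeft, whiskerRight_actionHomLeft,
    associator_inv_action, leftUnitor_inv_action, rightUnitor_actionHom] at h
  simpa using h

variable {M} in
lemma evaluation_coevaluation_action (m : M) :
    (η_ X Y) ⊵ₗ (X ⊙ₗ m) ≫ (αₗ X Y (X ⊙ₗ m)).hom ≫ X ⊴ₗ (αₗ Y X m).inv ≫ X ⊴ₗ (ε_ X Y) ⊵ₗ m =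
      (λₗ (X ⊙ₗ m)).hom ≫ X ⊴ₗ (λₗ m).inv := by
  have h := congrArg (fun t => (αₗ _ _ m).inv ≫ t ⊵ₗ m ≫ (αₗ _ _ m).hom)
    (ExactPairing.evaluation_coevaluation X Y)
  simp only [comp_actionHomLeft, whiskerLeft_actionHomLeft, whiskerRight_actionHomLeft,
    associator_hom_action, rightUnitor_inv_action, leftUnitor_actionHom] at h
  simpa using h

/-- If `Y` is a right dual of `X` then acting with `Y` is left adjoint to acting with `X`. -/
def actionAdjunction : actionLeft M Y ⊣ actionLeft M X where
  unit :=
    { app m := (λₗ m).inv ≫ (η_ X Y) ⊵ₗ m ≫ (αₗ X Y m).hom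
      naturality m n f := by
        have h := action_exchange (η_ X Y) f =≫ (αₗ X Y n).hom
        change f ≫ (λₗ n).inv ≫ (η_ X Y) ⊵ₗ n ≫ (αₗ X Y n).hom =
          ((λₗ m).inv ≫ (η_ X Y) ⊵ₗ m ≫ (αₗ X Y m).hom) ≫ X ⊴ₗ Y ⊴ₗ f
        rw [← cancel_epi (λₗ[A] m).hom]
        simpa using h }
  counit :=
    { app m := (αₗ Y X m).inv ≫ (ε_ X Y) ⊵ₗ m ≫ (λₗ m).hom
      naturality m n f := by
        have h := action_exchange (ε_ X Y) f =≫ (λₗ n).hom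
        change Y ⊴ₗ X ⊴ₗ f ≫ (αₗ Y X n).inv ≫ (ε_ X Y) ⊵ₗ n ≫ (λₗ n).hom =
          ((αₗ Y X m).inv ≫ (ε_ X Y) ⊵ₗ m ≫ (λₗ m).hom) ≫ f
        rw [← cancel_epi (αₗ Y X m).hom]
        simpa using h }
  left_triangle_components m := by
    have h := Y ⊴ₗ (λₗ m).inv ≫= coevaluation_evaluation_action X Y m =≫ (λₗ (Y ⊙ₗ m)).hom
    change Y ⊴ₗ ((λₗ m).inv ≫ (η_ X Y) ⊵ₗ m ≫ (αₗ X Y m).hom) ≫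
      (αₗ Y X (Y ⊙ₗ m)).inv ≫ (ε_ X Y) ⊵ₗ (Y ⊙ₗ m) ≫ (λₗ (Y ⊙ₗ m)).hom = 𝟙 (Y ⊙ₗ m)
    simpa using h
  right_triangle_components m := by
    have h := (λₗ (X ⊙ₗ m)).inv ≫= evaluation_coevaluation_action X Y m =≫ X ⊴ₗ (λₗ m).hom
    change ((λₗ (X ⊙ₗ m)).inv ≫ (η_ X Y) ⊵ₗ (X ⊙ₗ m) ≫ (αₗ X Y (X ⊙ₗ m)).hom) ≫
      X ⊴ₗ ((αₗ Y X m).inv ≫ (ε_ X Y) ⊵ₗ m ≫ (λₗ m).hom) = 𝟙 (X ⊙ₗ m)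
    simpa using h

variable {M}

/-- The morphism `Y ⊙ₗ X ⊙ₗ n ⟶ n` induced by the evaluation `Y ⊗ X ⟶ 𝟙`. -/
def dualEval (n : M) : Y ⊙ₗ X ⊙ₗ n ⟶ n := (αₗ Y X n).inv ≫ (ε_ X Y) ⊵ₗ n ≫ (λₗ n).hom

lemma dualEval_naturality {m n : M} (f : m ⟶ n) :
    Y ⊴ₗ X ⊴ₗ f ≫ dualEval X Y n = dualEval X Y m ≫ f :=
  (actionAdjunction M X Y).counit.naturality f

/-- The bijection `(Y ⊙ₗ m ⟶ n) ≃ (m ⟶ X ⊙ₗ n)` for `Y` a right dual of `X`. -/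
def actionHomEquiv (m n : M) : (Y ⊙ₗ m ⟶ n) ≃ (m ⟶ X ⊙ₗ n) :=
  (actionAdjunction M X Y).homEquiv m n

lemma actionHomEquiv_symm {m n : M} (g : m ⟶ X ⊙ₗ n) :
    (actionHomEquiv X Y m n).symm g = Y ⊴ₗ g ≫ dualEval X Y n :=
  (actionAdjunction M X Y).homEquiv_counit _ _ g

lemma actionHomEquiv_counit {m n : M} (f : Y ⊙ₗ m ⟶ n) :
    Y ⊴ₗ actionHomEquiv X Y m n f ≫ dualEval X Y n = f := by
  rw [← actionHomEquiv_symm, Equiv.symm_apply_apply]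

end DualAction

/-! ### Existence of the inner Hom -/

section Existence

variable {A : Type u₁} [Category.{v₁} A] [MonoidalCategory A]
  {M : Type u₂} [Category.{v₂} M] [MonoidalLeftAction A M]

/-- Right adjoints of the functors `a ↦ a ⊙ₗ m` assemble to an inner Hom. -/
noncomputable def InnerHom.ofIsLeftAdjoint (h : ∀ m : M, (actionRight A m).IsLeftAdjoint) :
    InnerHom A M where
  functor :=
    { obj m := (actionRight A m.unop).rightAdjoint
      map f := conjugateEquiv (Adjunction.ofIsLeftAdjoint _) (Adjunction.ofIsLeftAdjoint _)
        ((curriedAction A M).flip.map f.unop)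
      map_id m := by simp
      map_comp f g := by simp }
  adj₂ :=
    { adj m := Adjunction.ofIsLeftAdjoint (actionRight A m)
      unit_whiskerRight_map f := by
        ext a
        exact (unit_conjugateEquiv (Adjunction.ofIsLeftAdjoint (actionRight A _))
          (Adjunction.ofIsLeftAdjoint (actionRight A _)) ((curriedAction A M).flip.map f) a).symm }

end Existence

/-! ### Evaluation, composition and tensor compatibility of the inner Hom -/

namespace InnerHom

variable {A : Type u₁} [Category.{v₁} A] [MonoidalCategory A]
  {M : Type u₂} [Category.{v₂} M] [MonoidalLeftAction A M] (H : InnerHom A M)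

lemma mapLeft_id (m n : M) : H.mapLeft (𝟙 m) n = 𝟙 _ := by simp [mapLeft]

lemma mapLeft_comp {m m' m'' : M} (f : m ⟶ m') (g : m' ⟶ m'') (n : M) :
    H.mapLeft (f ≫ g) n = H.mapLeft g n ≫ H.mapLeft f n := by simp [mapLeft]

lemma mapRight_id (m n : M) : H.mapRight m (𝟙 n) = 𝟙 _ := (H.functor.obj (op m)).map_id n

lemma mapRight_comp (m : M) {n n' n'' : M} (f : n ⟶ n') (g : n' ⟶ n'') :
    H.mapRight m (f ≫ g) = H.mapRight m f ≫ H.mapRight m g := (H.functor.obj (op m)).map_comp f g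

lemma mapLeft_mapRight {m m' n n' : M} (f : m ⟶ m') (g : n ⟶ n') :
    H.mapLeft f n ≫ H.mapRight m g = H.mapRight m' g ≫ H.mapLeft f n' :=
  ((H.functor.map f.op).naturality g).symm

/-- The bijection `(a ⟶ IHom(m, n)) ≃ (a ⊙ₗ m ⟶ n)`. -/
def uncurry {a : A} {m n : M} : (a ⟶ H.obj m n) ≃ (a ⊙ₗ m ⟶ n) :=
  (H.adj₂.homEquiv (X₁ := m) (X₂ := a) (X₃ := n)).symm

lemma uncurry_comp {a b : A} {m n : M} (f : a ⟶ b) (g : b ⟶ H.obj m n) :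
    H.uncurry (f ≫ g) = f ⊵ₗ m ≫ H.uncurry g :=
  H.adj₂.homEquiv_symm_naturality_two f g

lemma uncurry_mapRight {a : A} {m n n' : M} (f : a ⟶ H.obj m n) (g : n ⟶ n') :
    H.uncurry (f ≫ H.mapRight m g) = H.uncurry f ≫ g :=
  H.adj₂.homEquiv_symm_naturality_three g f

lemma uncurry_mapLeft {a : A} {m m' n : M} (f : a ⟶ H.obj m' n) (g : m ⟶ m') :
    H.uncurry (f ≫ H.mapLeft g n) = a ⊴ₗ g ≫ H.uncurry f :=
  H.adj₂.homEquiv_symm_naturality_one g f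

/-- The evaluation morphism `IHom(m, n) ⊙ₗ m ⟶ n`. -/
def ev (m n : M) : H.obj m n ⊙ₗ m ⟶ n := H.uncurry (𝟙 _)

lemma uncurry_eq {a : A} {m n : M} (f : a ⟶ H.obj m n) : H.uncurry f = f ⊵ₗ m ≫ H.ev m n := by
  rw [ev, ← uncurry_comp, Category.comp_id]

lemma mapRight_ev (m : M) {n n' : M} (g : n ⟶ n') :
    H.mapRight m g ⊵ₗ m ≫ H.ev m n' = H.ev m n ≫ g := by
  rw [← uncurry_eq, ← Category.id_comp (H.mapRight m g), uncurry_mapRight, ev]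

lemma mapLeft_ev {m m' : M} (g : m ⟶ m') (n : M) :
    H.mapLeft g n ⊵ₗ m ≫ H.ev m n = H.obj m' n ⊴ₗ g ≫ H.ev m' n := by
  rw [← uncurry_eq, ← Category.id_comp (H.mapLeft g n), uncurry_mapLeft, ev]

/-- The canonical morphism `a ⊗ IHom(m, n) ⟶ IHom(m, a ⊙ₗ n)`. -/
def tensorHom (a : A) (m n : M) : a ⊗ H.obj m n ⟶ H.obj m (a ⊙ₗ n) :=
  H.uncurry.symm ((αₗ a (H.obj m n) m).hom ≫ a ⊴ₗ H.ev m n)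

/-- The composition `IHom(n, x) ⊗ IHom(m, n) ⟶ IHom(m, x)`. -/
def comp (m n x : M) : H.obj n x ⊗ H.obj m n ⟶ H.obj m x :=
  H.uncurry.symm ((αₗ (H.obj n x) (H.obj m n) m).hom ≫ H.obj n x ⊴ₗ H.ev m n ≫ H.ev n x)

lemma uncurry_comp_tensorHom {a c : A} {m n : M} (x : c ⟶ a ⊗ H.obj m n) :
    H.uncurry (x ≫ H.tensorHom a m n) = x ⊵ₗ m ≫ (αₗ a (H.obj m n) m).hom ≫ a ⊴ₗ H.ev m n := by
  rw [uncurry_comp, tensorHom, Equiv.apply_symm_apply]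

lemma uncurry_comp_comp {c : A} {m n x : M} (y : c ⟶ H.obj n x ⊗ H.obj m n) :
    H.uncurry (y ≫ H.comp m n x) =
      y ⊵ₗ m ≫ (αₗ (H.obj n x) (H.obj m n) m).hom ≫ H.obj n x ⊴ₗ H.ev m n ≫ H.ev n x := by
  rw [uncurry_comp, comp, Equiv.apply_symm_apply]

/-- The pairing of `y : a ⟶ IHom(n, x)` with `IHom(m, n)` in terms of the adjunct of `y`. -/
lemma whiskerRight_comp_eq_tensorHom {a : A} (m : M) {n x : M} (y : a ⟶ H.obj n x) :
    y ▷ H.obj m n ≫ H.comp m n x = H.tensorHom a m n ≫ H.mapRight m (H.uncurry y) := by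
  apply H.uncurry.injective
  rw [uncurry_comp_comp, uncurry_mapRight, ← Category.id_comp (H.tensorHom a m n),
    uncurry_comp_tensorHom, uncurry_eq, whiskerRight_actionHomLeft]
  simp [action_exchange_assoc]

lemma mapRight_whiskerRight_comp (m n : M) {x x' : M} (g : x ⟶ x') :
    H.mapRight n g ▷ H.obj m n ≫ H.comp m n x' = H.comp m n x ≫ H.mapRight m g := by
  apply H.uncurry.injective
  rw [uncurry_comp_comp, uncurry_mapRight, ← Category.id_comp (H.comp m n x),
    uncurry_comp_comp, whiskerRight_actionHomLeft]
  simp only [Category.assoc, Iso.inv_hom_id_assoc, ← action_exchange_assoc, mapRight_ev,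
    id_actionHomLeft, Category.id_comp]

lemma mapLeft_whiskerRight_comp (m : M) {n n' : M} (g : n ⟶ n') (x : M) :
    H.mapLeft g x ▷ H.obj m n ≫ H.comp m n x = H.obj n' x ◁ H.mapRight m g ≫ H.comp m n' x := by
  apply H.uncurry.injective
  rw [uncurry_comp_comp, uncurry_comp_comp, whiskerRight_actionHomLeft, whiskerLeft_actionHomLeft]
  simp only [Category.assoc, Iso.inv_hom_id_assoc, ← action_exchange_assoc, mapLeft_ev]
  simp only [← actionHomRight_comp_assoc, mapRight_ev]

lemma comp_mapLeft {m m' : M} (g : m ⟶ m') (n x : M) :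
    H.comp m' n x ≫ H.mapLeft g x = H.obj n x ◁ H.mapLeft g n ≫ H.comp m n x := by
  apply H.uncurry.injective
  rw [uncurry_comp_comp, uncurry_mapLeft, ← Category.id_comp (H.comp m' n x),
    uncurry_comp_comp, whiskerLeft_actionHomLeft]
  simp only [Category.assoc, Iso.inv_hom_id_assoc]
  simp only [← actionHomRight_comp_assoc, mapLeft_ev]
  simp

/-- Both `c ⟶ a ⊗ IHom(m, n)` and `c ⟶ IHom(m, a ⊙ₗ n)` correspond to morphisms
`(a' ⊗ c) ⊙ₗ m ⟶ n`, and composing with `tensorHom` is the resulting bijection. -/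
lemma tensorHom_bijective (a a' : A) [ExactPairing a a'] (m n : M) (c : A) :
    Function.Bijective fun x : c ⟶ a ⊗ H.obj m n => x ≫ H.tensorHom a m n := by
  let e : (c ⟶ a ⊗ H.obj m n) ≃ (c ⟶ H.obj m (a ⊙ₗ n)) :=
    (tensorLeftHomEquiv c a a' (H.obj m n)).symm.trans <| H.uncurry.trans <|
      (αₗ a' c m).homFromEquiv.trans <|
        (actionHomEquiv a a' (c ⊙ₗ m) n).trans H.uncurry.symm
  convert e.bijective using 1
  funext x
  apply H.uncurry.injective
  apply (actionHomEquiv a a' (c ⊙ₗ m) n).symm.injective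
  have he : H.uncurry (e x) = actionHomEquiv a a' (c ⊙ₗ m) n ((αₗ a' c m).inv ≫
      H.uncurry ((tensorLeftHomEquiv c a a' (H.obj m n)).symm x)) := by
    simp [e]
  rw [he, Equiv.symm_apply_apply, actionHomEquiv_symm, uncurry_comp_tensorHom, uncurry_eq]
  have h := dualEval_naturality a a' (H.ev m n)
  simp only [actionHomRight_comp, Category.assoc, h]
  simp [tensorLeftHomEquiv, dualEval, associator_inv_action]

instance isIso_tensorHom [RightRigidCategory A] (a : A) (m n : M) : IsIso (H.tensorHom a m n) :=
  (isIso_iff_yoneda_map_bijective _).2 fun c => H.tensorHom_bijective a aᘁ m n c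

/-- The canonical morphism `IHom(m, n) ⊗ a ⟶ IHom(b ⊙ₗ m, n)` for `a` a right dual of `b`. -/
def tensorDualHom (b a : A) [ExactPairing b a] (m n : M) : H.obj m n ⊗ a ⟶ H.obj (b ⊙ₗ m) n :=
  H.uncurry.symm ((αₗ (H.obj m n) a (b ⊙ₗ m)).hom ≫
    H.obj m n ⊴ₗ dualEval b a m ≫ H.ev m n)

lemma uncurry_comp_tensorDualHom (b a : A) [ExactPairing b a] {c : A} {m n : M}
    (x : c ⟶ H.obj m n ⊗ a) :
    H.uncurry (x ≫ H.tensorDualHom b a m n) =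
      x ⊵ₗ (b ⊙ₗ m) ≫ (αₗ (H.obj m n) a (b ⊙ₗ m)).hom ≫
        H.obj m n ⊴ₗ dualEval b a m ≫ H.ev m n := by
  rw [uncurry_comp, tensorDualHom, Equiv.apply_symm_apply]

/-- Both `c ⟶ IHom(m, n) ⊗ a` and `c ⟶ IHom(b ⊙ₗ m, n)` correspond to morphisms
`(c ⊗ b) ⊙ₗ m ⟶ n`, and composing with `tensorDualHom` is the resulting bijection. -/
lemma tensorDualHom_bijective (b a : A) [ExactPairing b a] (m n : M) (c : A) :
    Function.Bijective fun x : c ⟶ H.obj m n ⊗ a => x ≫ H.tensorDualHom b a m n := by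
  let e : (c ⟶ H.obj m n ⊗ a) ≃ (c ⟶ H.obj (b ⊙ₗ m) n) :=
    (tensorRightHomEquiv c b a (H.obj m n)).symm.trans <| H.uncurry.trans <|
      (αₗ c b m).homFromEquiv.trans H.uncurry.symm
  convert e.bijective using 1
  funext x
  refine H.uncurry.injective ?_
  have he : H.uncurry (e x) = (αₗ c b m).inv ≫
      H.uncurry ((tensorRightHomEquiv c b a (H.obj m n)).symm x) := by
    simp [e]
  rw [he, uncurry_comp_tensorDualHom, uncurry_eq]
  simp [tensorRightHomEquiv, dualEval, associator_hom_action]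

instance isIso_tensorDualHom (b a : A) [ExactPairing b a] (m n : M) :
    IsIso (H.tensorDualHom b a m n) :=
  (isIso_iff_yoneda_map_bijective _).2 fun c => H.tensorDualHom_bijective b a m n c

/-- The pairing of `IHom(m, n)` with `x : a ⟶ IHom(s, m)` in terms of the morphism `s ⟶ b ⊙ₗ m`
that corresponds to `x`. -/
lemma whiskerLeft_comp_eq_tensorDualHom (b a : A) [ExactPairing b a] {m n s : M}
    (x : a ⟶ H.obj s m) :
    H.obj m n ◁ x ≫ H.comp s m n = H.tensorDualHom b a m n ≫
      H.mapLeft (actionHomEquiv b a s m (H.uncurry x)) n := by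
  apply H.uncurry.injective
  rw [uncurry_comp_comp, uncurry_mapLeft, ← Category.id_comp (H.tensorDualHom b a m n),
    uncurry_comp_tensorDualHom, whiskerLeft_actionHomLeft]
  simp only [Category.assoc, Iso.inv_hom_id_assoc, ← actionHomRight_comp_assoc]
  have h := actionHomEquiv_counit b a (H.uncurry x)
  generalize actionHomEquiv b a s m (H.uncurry x) = y at h ⊢
  rw [← uncurry_eq, ← h]
  simp

end InnerHom

/-! ### Universal pairings -/

section WeakDual

variable {A : Type u₁} [Category.{v₁} A] [MonoidalCategory A]

lemma whiskerRight_evaluation_bijective (X Y a : A) [ExactPairing X Y] :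
    Function.Bijective fun x : a ⟶ Y => x ▷ X ≫ ε_ X Y := by
  let e : (a ⟶ Y) ≃ (a ⊗ X ⟶ 𝟙_ A) :=
    (λ_ Y).symm.homToEquiv.trans (tensorRightHomEquiv a X Y (𝟙_ A)).symm
  convert e.bijective using 1
  funext x
  simp [e, tensorRightHomEquiv, ← unitors_equal]

lemma whiskerLeft_evaluation_bijective (X Y a : A) [ExactPairing X Y] :
    Function.Bijective fun x : a ⟶ X => Y ◁ x ≫ ε_ X Y := by
  let e : (a ⟶ X) ≃ (Y ⊗ a ⟶ 𝟙_ A) :=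
    (ρ_ X).symm.homToEquiv.trans (tensorLeftHomEquiv a X Y (𝟙_ A)).symm
  convert e.bijective using 1
  funext x
  simp [e, tensorLeftHomEquiv, unitors_equal]

/-- A pairing `β : Z ⊗ X ⟶ 𝟙` through which every morphism `a ⊗ X ⟶ 𝟙` factors uniquely
identifies `Z` with the right dual of `X`. -/
lemma exists_iso_rightDual {X Z : A} [HasRightDual X] (β : Z ⊗ X ⟶ 𝟙_ A)
    (hβ : ∀ a : A, Function.Bijective fun x : a ⟶ Z => x ▷ X ≫ β) :
    ∃ i : Xᘁ ≅ Z, i.hom ▷ X ≫ β = ε_ X Xᘁ := by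
  obtain ⟨f, hf⟩ := (hβ Xᘁ).2 (ε_ X Xᘁ)
  obtain ⟨g, hg⟩ := (whiskerRight_evaluation_bijective X Xᘁ Z).2 β
  dsimp only at hf hg
  refine ⟨⟨f, g, (whiskerRight_evaluation_bijective X Xᘁ Xᘁ).1 ?_, (hβ Z).1 ?_⟩, hf⟩
  · simp [hg, hf]
  · simp [hg, hf]

/-- A pairing `β : X ⊗ Z ⟶ 𝟙` through which every morphism `X ⊗ a ⟶ 𝟙` factors uniquely
identifies `Z` with the left dual of `X`. -/
lemma exists_iso_leftDual {X Z : A} [HasLeftDual X] (β : X ⊗ Z ⟶ 𝟙_ A)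
    (hβ : ∀ a : A, Function.Bijective fun x : a ⟶ Z => X ◁ x ≫ β) :
    ∃ i : (ᘁX) ≅ Z, X ◁ i.hom ≫ β = ε_ (ᘁX) X := by
  obtain ⟨f, hf⟩ := (hβ (ᘁX)).2 (ε_ (ᘁX) X)
  obtain ⟨g, hg⟩ := (whiskerLeft_evaluation_bijective (ᘁX) X Z).2 β
  dsimp only at hf hg
  refine ⟨⟨f, g, (whiskerLeft_evaluation_bijective (ᘁX) X (ᘁX)).1 ?_, (hβ Z).1 ?_⟩, hf⟩
  · simp [hg, hf]
  · simp [hg, hf]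

end WeakDual

/-! ### Linearity of the inner Hom -/

section Linearity

variable (k : Type w) [Field k] {A : Type u₁} [Category.{v₁} A] [Preadditive A] [Linear k A]
  [MonoidalCategory A] {M : Type u₂} [Category.{v₂} M] [Preadditive M] [Linear k M]
  [MonoidalLeftAction A M]

namespace InnerHom

variable (H : InnerHom A M)

lemma uncurry_add [IsModuleCategory k A M] {a : A} {m n : M} (f g : a ⟶ H.obj m n) :
    H.uncurry (f + g) = H.uncurry f + H.uncurry g := by
  have := IsModuleCategory.actionRight_additive (k := k) (A := A) m
  rw [uncurry_eq, uncurry_eq, uncurry_eq, ← Preadditive.add_comp]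
  exact congrArg (· ≫ H.ev m n) ((actionRight A m).map_add)

lemma uncurry_zero [IsModuleCategory k A M] {a : A} {m n : M} :
    H.uncurry (0 : a ⟶ H.obj m n) = 0 := by
  have h := H.uncurry_add k (0 : a ⟶ H.obj m n) 0
  rwa [add_zero, left_eq_add] at h

lemma uncurry_smul [IsModuleCategory k A M] {a : A} {m n : M} (c : k) (f : a ⟶ H.obj m n) :
    H.uncurry (c • f) = c • H.uncurry f := by
  have := IsModuleCategory.actionRight_additive (k := k) (A := A) m
  have := IsModuleCategory.actionRight_linear (k := k) (A := A) m
  rw [uncurry_eq, uncurry_eq, ← Linear.smul_comp]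
  exact congrArg (· ≫ H.ev m n) ((actionRight A m).map_smul c f)

lemma mapRight_add [IsModuleCategory k A M] (m : M) {n n' : M} (f g : n ⟶ n') :
    H.mapRight m (f + g) = H.mapRight m f + H.mapRight m g := by
  apply H.uncurry.injective
  rw [uncurry_add k, uncurry_eq, uncurry_eq, uncurry_eq]
  simp only [mapRight_ev, Preadditive.comp_add]

lemma mapRight_smul [IsModuleCategory k A M] (m : M) {n n' : M} (c : k) (f : n ⟶ n') :
    H.mapRight m (c • f) = c • H.mapRight m f := by
  apply H.uncurry.injective
  rw [uncurry_smul, uncurry_eq, uncurry_eq]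
  simp only [mapRight_ev, Linear.comp_smul]

lemma mapLeft_add [IsModuleCategory k A M] {m m' : M} (f g : m ⟶ m') (n : M) :
    H.mapLeft (f + g) n = H.mapLeft f n + H.mapLeft g n := by
  have := IsModuleCategory.actionLeft_additive (k := k) (M := M) (H.obj m' n)
  apply H.uncurry.injective
  rw [uncurry_add k, uncurry_eq, uncurry_eq, uncurry_eq]
  simp only [mapLeft_ev, ← Preadditive.add_comp]
  exact congrArg (· ≫ H.ev m' n) ((actionLeft M (H.obj m' n)).map_add)

lemma mapLeft_smul [IsModuleCategory k A M] {m m' : M} (c : k) (f : m ⟶ m') (n : M) :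
    H.mapLeft (c • f) n = c • H.mapLeft f n := by
  have := IsModuleCategory.actionLeft_additive (k := k) (M := M) (H.obj m' n)
  have := IsModuleCategory.actionLeft_linear (k := k) (M := M) (H.obj m' n)
  apply H.uncurry.injective
  rw [uncurry_smul, uncurry_eq, uncurry_eq]
  simp only [mapLeft_ev, ← Linear.smul_comp]
  exact congrArg (· ≫ H.ev m' n) ((actionLeft M (H.obj m' n)).map_smul c f)

end InnerHom

end Linearity

/-! ### Relative Serre functors from universal arrows -/

section Construction

variable (k : Type w) [Field k] {A : Type u₁} [Category.{v₁} A] [Preadditive A] [Linear k A]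
  [MonoidalCategory A] [RigidCategory A] {M : Type u₂} [Category.{v₂} M] [Preadditive M]
  [Linear k M] [MonoidalLeftAction A M] [IsModuleCategory k A M] (H : InnerHom A M)

/-- A right relative Serre functor exists if all functors `n ↦ Hom(IHom(m, n), 𝟙)` are
represented, say by `S m` with the universal element `φ m`. Composition followed by `φ m` pairs
`IHom(n, S m)` with `IHom(m, n)`, and this pairing is universal since morphisms
`a ⊗ IHom(m, n) ≅ IHom(m, a ⊙ₗ n) ⟶ 𝟙` are morphisms `a ⊙ₗ n ⟶ S m`. -/
theorem nonempty_rightRelativeSerreFunctor (S : M → M) (φ : ∀ m, H.obj m (S m) ⟶ 𝟙_ A)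
    (hφ : ∀ m n : M, Function.Bijective fun f : n ⟶ S m => H.mapRight m f ≫ φ m) :
    Nonempty (RightRelativeSerreFunctor k H) := by
  have inj {m n : M} {f g : n ⟶ S m} (h : H.mapRight m f ≫ φ m = H.mapRight m g ≫ φ m) : f = g :=
    (hφ m n).1 h
  -- The action of `S` on morphisms is determined by compatibility with the universal elements.
  choose T hT using fun (m m' : M) (f : m ⟶ m') => (hφ m' (S m)).2 (H.mapLeft f (S m) ≫ φ m)
  dsimp only at hT
  let β (m n : M) : H.obj n (S m) ⊗ H.obj m n ⟶ 𝟙_ A := H.comp m n (S m) ≫ φ m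
  have hβ (m n : M) (a : A) :
      Function.Bijective fun x : a ⟶ H.obj n (S m) => x ▷ H.obj m n ≫ β m n := by
    convert ((asIso (H.tensorHom a m n)).homFromEquiv (Z := 𝟙_ A)).symm.bijective.comp
      ((hφ m (a ⊙ₗ n)).comp H.uncurry.bijective) using 1
    funext x
    simp [β, ← Category.assoc, InnerHom.whiskerRight_comp_eq_tensorHom]
  -- Naturality is checked after pairing, where it becomes dinaturality of the composition.
  choose i hi using fun m n => exists_iso_rightDual (β m n) (hβ m n)
  refine ⟨{
    functor :=
      { obj := S
        map f := T _ _ f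
        map_id m := inj (by rw [hT]; rw [H.mapLeft_id, H.mapRight_id])
        map_comp {m m' m''} f g := inj ?_ }
    additive := ⟨fun {m m' f g} => inj ?_⟩
    linear := ⟨fun {m m'} f c => inj ?_⟩
    iso := i
    naturality_left {m m'} f n := (hβ m' n _).1 ?_
    naturality_right m {n n'} g := (hβ m n _).1 ?_ }⟩
  · rw [hT, H.mapLeft_comp, H.mapRight_comp, Category.assoc, Category.assoc, hT,
      ← reassoc_of% H.mapLeft_mapRight, hT]
  · dsimp only
    rw [hT, H.mapLeft_add k, H.mapRight_add k, Preadditive.add_comp, Preadditive.add_comp, hT, hT]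
  · dsimp only
    rw [hT, H.mapLeft_smul k, H.mapRight_smul k, Linear.smul_comp, Linear.smul_comp, hT]
  · have h : H.mapRight n (T m m' f) ▷ H.obj m' n ≫ β m' n =
        H.obj n (S m) ◁ H.mapLeft f n ≫ β m n := by
      simp only [β]
      rw [reassoc_of% H.mapRight_whiskerRight_comp, hT, reassoc_of% H.comp_mapLeft]
    dsimp only
    rw [comp_whiskerRight, comp_whiskerRight, Category.assoc, Category.assoc, h, hi,
      rightAdjointMate_comp_evaluation, ← whisker_exchange_assoc, hi]
  · have h : H.mapLeft g (S m) ▷ H.obj m n ≫ β m n =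
        H.obj n' (S m) ◁ H.mapRight m g ≫ β m n' :=
      by
      simp only [β, reassoc_of% H.mapLeft_whiskerRight_comp]
    dsimp only
    rw [comp_whiskerRight, comp_whiskerRight, Category.assoc, Category.assoc, h, hi,
      rightAdjointMate_comp_evaluation, ← whisker_exchange_assoc, hi]

/-- A left relative Serre functor exists if all functors `m ↦ Hom(IHom(m, n), 𝟙)` are
corepresented, say by `S n` with the universal element `ψ n`. Composition followed by `ψ n` pairs
`IHom(m, n)` with `IHom(S n, m)`, and this pairing is universal since, for `b` a left dual of `a`,
morphisms `IHom(m, n) ⊗ a ≅ IHom(b ⊙ₗ m, n) ⟶ 𝟙` are morphisms `S n ⟶ b ⊙ₗ m`, that is,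
morphisms `a ⊙ₗ S n ⟶ m`. -/
theorem nonempty_leftRelativeSerreFunctor (S : M → M) (ψ : ∀ n, H.obj (S n) n ⟶ 𝟙_ A)
    (hψ : ∀ m n : M, Function.Bijective fun f : S n ⟶ m => H.mapLeft f n ≫ ψ n) :
    Nonempty (LeftRelativeSerreFunctor k H) := by
  have inj {m n : M} {f g : S n ⟶ m} (h : H.mapLeft f n ≫ ψ n = H.mapLeft g n ≫ ψ n) : f = g :=
    (hψ m n).1 h
  choose T hT using fun (n n' : M) (g : n ⟶ n') => (hψ (S n') n).2 (H.mapRight (S n') g ≫ ψ n')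
  dsimp only at hT
  let β (m n : M) : H.obj m n ⊗ H.obj (S n) m ⟶ 𝟙_ A := H.comp (S n) m n ≫ ψ n
  have hβ (m n : M) (a : A) :
      Function.Bijective fun x : a ⟶ H.obj (S n) m => H.obj m n ◁ x ≫ β m n := by
    convert ((asIso (H.tensorDualHom (ᘁa) a m n)).homFromEquiv (Z := 𝟙_ A)).symm.bijective.comp
      ((hψ ((ᘁa) ⊙ₗ m) n).comp
        ((actionHomEquiv (ᘁa) a (S n) m).bijective.comp H.uncurry.bijective)) using 1
    funext x
    simp [β, ← Category.assoc, H.whiskerLeft_comp_eq_tensorDualHom (ᘁa) a]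
  choose i hi using fun m n => exists_iso_leftDual (β m n) (hβ m n)
  refine ⟨{
    functor :=
      { obj := S
        map f := T _ _ f
        map_id m := inj (by rw [hT]; rw [H.mapLeft_id, H.mapRight_id])
        map_comp {m m' m''} f g := inj ?_ }
    additive := ⟨fun {m m' f g} => inj ?_⟩
    linear := ⟨fun {m m'} f c => inj ?_⟩
    iso := i
    naturality_left {m m'} f n := (hβ m' n _).1 ?_
    naturality_right m {n n'} g := (hβ m n _).1 ?_ }⟩
  · rw [hT, H.mapLeft_comp, H.mapRight_comp, Category.assoc, Category.assoc, hT,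
      reassoc_of% H.mapLeft_mapRight, hT]
  · dsimp only
    rw [hT, H.mapLeft_add k, H.mapRight_add k, Preadditive.add_comp, Preadditive.add_comp, hT, hT]
  · dsimp only
    rw [hT, H.mapLeft_smul k, H.mapRight_smul k, Linear.smul_comp, Linear.smul_comp, hT]
  · have h : H.obj m' n ◁ H.mapRight (S n) f ≫ β m' n = H.mapLeft f n ▷ H.obj (S n) m ≫ β m n :=
      by
      simp only [β, reassoc_of% H.mapLeft_whiskerRight_comp]
    dsimp only
    rw [whiskerLeft_comp, whiskerLeft_comp, Category.assoc, Category.assoc, h, hi,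
      leftAdjointMate_comp_evaluation, whisker_exchange_assoc, hi]
  · have h : H.obj m n ◁ H.mapLeft (T n n' g) m ≫ β m n =
        H.mapRight m g ▷ H.obj (S n') m ≫ β m n' := by
      simp only [β]
      rw [reassoc_of% H.mapRight_whiskerRight_comp, ← hT, reassoc_of% H.comp_mapLeft]
    dsimp only
    rw [whiskerLeft_comp, whiskerLeft_comp, Category.assoc, Category.assoc, h, hi,
      leftAdjointMate_comp_evaluation, whisker_exchange_assoc, hi]

end Construction

/-! ### From Serre functors to exactness -/

section ExactOfSerre

variable {A : Type u₁} [Category.{v₁} A] [MonoidalCategory A]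

/-- Taking mates is contravariant and faithful, so it reflects monomorphisms to epimorphisms. -/
lemma epi_of_mono_rightAdjointMate [RightRigidCategory A] {X Y : A} (f : X ⟶ Y) [Mono (fᘁ)] :
    Epi f where
  left_cancellation {Z} u v h := by
    have h' : uᘁ = vᘁ := by
      rw [← cancel_mono (fᘁ), ← comp_rightAdjointMate, ← comp_rightAdjointMate, h]
    refine (whiskerLeft_evaluation_bijective Z Zᘁ Y).1 ?_
    dsimp only
    rw [← rightAdjointMate_comp_evaluation, ← rightAdjointMate_comp_evaluation, h']

variable {M : Type u₂} [Category.{v₂} M] [MonoidalLeftAction A M]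

instance [RigidCategory A] (a : A) : (actionLeft M a).IsLeftAdjoint :=
  (actionAdjunction M (ᘁa) a).isLeftAdjoint

instance [RigidCategory A] (a : A) : (actionLeft M a).IsRightAdjoint :=
  (actionAdjunction M a aᘁ).isRightAdjoint

instance [RigidCategory A] (a : A) {m n : M} (f : m ⟶ n) [Epi f] : Epi (a ⊴ₗ f) :=
  inferInstanceAs (Epi ((actionLeft M a).map f))

namespace InnerHom

variable (H : InnerHom A M)

lemma mono_mapLeft [RigidCategory A] {m m' : M} (f : m ⟶ m') [Epi f] (n : M) :
    Mono (H.mapLeft f n) where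
  right_cancellation {c} x y h := by
    apply H.uncurry.injective
    rw [← cancel_epi (c ⊴ₗ f), ← uncurry_mapLeft, ← uncurry_mapLeft, h]

/-- If `IHom(m, -)` preserves epimorphisms, then acting on `m` preserves projectives. -/
lemma projective_action (m : M)
    (h : ∀ ⦃n n' : M⦄ (e : n ⟶ n'), Epi e → Epi (H.mapRight m e)) (p : A) [Projective p] :
    Projective (p ⊙ₗ m) where
  factors {n' n} f e he := by
    have := h e he
    refine ⟨H.uncurry (Projective.factorThru (H.uncurry.symm f) (H.mapRight m e)), ?_⟩
    rw [← uncurry_mapRight, Projective.factorThru_comp, Equiv.apply_symm_apply]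

end InnerHom

/-- If a right relative Serre functor exists, then `IHom(m, -)` is, up to the duality of `A`, the
functor `IHom(-, S m)`, which takes epimorphisms to monomorphisms. -/
theorem RightRelativeSerreFunctor.isExactModuleCategory {k : Type w} [Field k] [RigidCategory A]
    [Preadditive M] [Linear k M] {H : InnerHom A M} (S : RightRelativeSerreFunctor k H) :
    IsExactModuleCategory A M := fun p m _ => H.projective_action m (fun n n' e _ => by
  have := H.mono_mapLeft e (S.functor.obj m)
  have h : (H.mapRight m e)ᘁ = (S.iso m n').hom ≫ H.mapLeft e (S.functor.obj m) ≫
      (S.iso m n).inv := by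
    rw [← Category.assoc, Iso.eq_comp_inv, S.naturality_right]
  have : Mono ((H.mapRight m e)ᘁ) := h ▸ inferInstance
  exact epi_of_mono_rightAdjointMate _) p

end ExactOfSerre

/-! ### From exactness to Serre functors -/

section SerreOfExact

variable (k : Type w) [Field k] {A : Type u₁} [Category.{v₁} A] [Abelian A] [Linear k A]
  [MonoidalCategory A] {M : Type u₂} [Category.{v₂} M] [MonoidalLeftAction A M] (H : InnerHom A M)

/-- In an exact module category, `IHom(m, -)` preserves epimorphisms: lifting a morphism
`P ⟶ IHom(m, n')` amounts to lifting a morphism out of the projective object `P ⊙ₗ m`. -/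
lemma InnerHom.epi_mapRight [IsFiniteLinearCategory k A] (hM : IsExactModuleCategory A M) (m : M)
    {n n' : M} (e : n ⟶ n') [Epi e] :
    Epi (H.mapRight m e) := by
  obtain ⟨P, _, hP⟩ := exists_projective_separator k A
  refine Preadditive.epi_of_cancel_zero _ fun g hg =>
    (Preadditive.isSeparator_iff P).1 hP g fun x => ?_
  have := hM P m inferInstance
  have hx : H.uncurry.symm (Projective.factorThru (H.uncurry x) e) ≫ H.mapRight m e = x := by
    apply H.uncurry.injective
    rw [uncurry_mapRight, Equiv.apply_symm_apply, Projective.factorThru_comp]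
  rw [← hx, Category.assoc, hg, comp_zero]

variable [Abelian M] [Linear k M]

lemma nonempty_innerHom [IsFiniteLinearCategory k A] [IsModuleCategory k A M] :
    Nonempty (InnerHom A M) :=
  ⟨InnerHom.ofIsLeftAdjoint fun m => by
    have := IsModuleCategory.actionRight_additive (k := k) (A := A) m
    have := IsModuleCategory.actionRight_linear (k := k) (A := A) m
    have := IsModuleCategory.actionRight_preservesFiniteColimits (k := k) (A := A) m
    exact isLeftAdjoint_of_rightExact k _⟩

/-- In an exact module category, `IHom(m, -)` is exact: it is a right adjoint and preserves
epimorphisms. Hence it has a right adjoint. -/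
lemma InnerHom.functor_obj_isLeftAdjoint [IsFiniteLinearCategory k A] [IsModuleCategory k A M]
    (hM : IsExactModuleCategory A M) (m : M) :
    (H.functor.obj (op m)).IsLeftAdjoint := by
  have : IsFiniteLinearCategory k M := IsModuleCategory.toIsFiniteLinearCategory A
  have : (H.functor.obj (op m)).Additive := ⟨fun {_ _ f g} => H.mapRight_add k m f g⟩
  have : (H.functor.obj (op m)).Linear k := ⟨fun f c => H.mapRight_smul k m c f⟩
  have : (H.functor.obj (op m)).IsRightAdjoint := (H.adj₂.adj m).isRightAdjoint
  have : PreservesFiniteColimits (H.functor.obj (op m)) := by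
    refine (Functor.preservesFiniteColimits_iff_forall_exact_map_and_epi _).2 fun S hS => ⟨?_, ?_⟩
    · exact ((Functor.preservesFiniteLimits_iff_forall_exact_map_and_mono
        (H.functor.obj (op m))).1 inferInstance S hS).1
    · have := hS.epi_g
      exact H.epi_mapRight k hM m S.g
  exact isLeftAdjoint_of_rightExact k _

variable [RigidCategory A]

namespace InnerHom

/-- In an exact module category, `IHom(-, n)` takes monomorphisms to epimorphisms: for a
monomorphism `j`, the short exact sequence obtained by acting on `j` and its cokernel with a
projective object `P` ends in a projective object, so it splits, and morphisms `P ⊙ₗ m ⟶ n`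
extend along `P ⊴ₗ j`. -/
lemma epi_mapLeft [IsFiniteLinearCategory k A] [IsModuleCategory k A M]
    (hM : IsExactModuleCategory A M) {m m' : M} (j : m ⟶ m') [Mono j] (n : M) :
    Epi (H.mapLeft j n) := by
  obtain ⟨P, _, hP⟩ := exists_projective_separator k A
  refine Preadditive.epi_of_cancel_zero _ fun g hg =>
    (Preadditive.isSeparator_iff P).1 hP g fun x => ?_
  have := IsModuleCategory.actionLeft_additive (k := k) (M := M) P
  have hS : (ShortComplex.mk j (cokernel.π j) (cokernel.condition j)).ShortExact :=
    { exact := ShortComplex.exact_cokernel j }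
  have hPS := hS.map_of_exact (actionLeft M P)
  have : Projective (((ShortComplex.mk j (cokernel.π j) (cokernel.condition j)).map
    (actionLeft M P)).X₃) := hM P _ inferInstance
  obtain ⟨r, hr⟩ : ∃ r : P ⊙ₗ m' ⟶ P ⊙ₗ m, P ⊴ₗ j ≫ r = 𝟙 (P ⊙ₗ m) :=
    ⟨hPS.splittingOfProjective.r, hPS.splittingOfProjective.f_r⟩
  have hx : H.uncurry.symm (r ≫ H.uncurry x) ≫ H.mapLeft j n = x := by
    apply H.uncurry.injective
    rw [uncurry_mapLeft, Equiv.apply_symm_apply, reassoc_of% hr]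
  rw [← hx, Category.assoc, hg, comp_zero]

/-- A short exact sequence `m₁ ⟶ m₂ ⟶ m₃` yields an exact sequence
`0 ⟶ IHom(m₃, n) ⟶ IHom(m₂, n) ⟶ IHom(m₁, n)`, since acting with any object is exact. -/
lemma exists_comp_mapLeft [IsModuleCategory k A M] {S : ShortComplex M} (hS : S.ShortExact) (n : M)
    {c : A} (x : c ⟶ H.obj S.X₂ n) (hx : x ≫ H.mapLeft S.f n = 0) :
    ∃ y : c ⟶ H.obj S.X₃ n, y ≫ H.mapLeft S.g n = x := by
  have := IsModuleCategory.actionLeft_additive (k := k) (M := M) c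
  have hc := hS.map_of_exact (actionLeft M c)
  have := hc.epi_g
  have h0 : c ⊴ₗ S.f ≫ H.uncurry x = 0 := by
    rw [← uncurry_mapLeft, hx, uncurry_zero k]
  obtain ⟨y, hy⟩ : ∃ y : c ⊙ₗ S.X₃ ⟶ n, c ⊴ₗ S.g ≫ y = H.uncurry x :=
    ⟨hc.exact.desc (H.uncurry x) h0, hc.exact.g_desc _ _⟩
  exact ⟨H.uncurry.symm y, H.uncurry.injective
    (by rw [uncurry_mapLeft, Equiv.apply_symm_apply, hy])⟩

/-- In an exact module category, `IHom(-, n) : Mᵒᵖ ⥤ A` is exact. Hence it has a right adjoint. -/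
lemma functor_flip_obj_isLeftAdjoint [IsFiniteLinearCategory k A] [IsModuleCategory k A M]
    (hM : IsExactModuleCategory A M) (n : M) :
    (H.functor.flip.obj n).IsLeftAdjoint := by
  have : IsFiniteLinearCategory k M := IsModuleCategory.toIsFiniteLinearCategory A
  have : (H.functor.flip.obj n).Additive := ⟨fun {_ _ f g} => H.mapLeft_add k f.unop g.unop n⟩
  have : PreservesFiniteColimits (H.functor.flip.obj n) := by
    refine (Functor.preservesFiniteColimits_iff_forall_exact_map_and_epi _).2 fun S hS => ⟨?_, ?_⟩
    · refine ShortComplex.exact_of_f_is_kernel _ ?_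
      have := hS.mono_f
      have : Mono (H.mapLeft S.f.unop n) := H.mono_mapLeft S.f.unop n
      choose l hl using fun (c : A) (x : c ⟶ H.obj S.X₂.unop n)
        (hx : x ≫ H.mapLeft S.g.unop n = 0) => H.exists_comp_mapLeft k hS.unop n x hx
      exact KernelFork.IsLimit.ofι' (H.mapLeft S.f.unop n) _ fun x hx => ⟨l _ x hx, hl _ x hx⟩
    · have := hS.epi_g
      exact H.epi_mapLeft k hM S.g.unop n
  exact isLeftAdjoint_of_rightExact_op k _ fun _ _ c f => H.mapLeft_smul k c f n

end InnerHom

/-- An exact module category has both relative Serre functors: `Sʳ m` represents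
`Hom(IHom(m, -), 𝟙)` and `Sˡ n` corepresents `Hom(IHom(-, n), 𝟙)`. -/
theorem IsExactModuleCategory.nonempty_relativeSerreFunctors
    [IsFiniteLinearCategory k A] [IsModuleCategory k A M] (hM : IsExactModuleCategory A M) :
    Nonempty (LeftRelativeSerreFunctor k H) ∧ Nonempty (RightRelativeSerreFunctor k H) := by
  constructor
  · have h := fun n => H.functor_flip_obj_isLeftAdjoint k hM n
    let adj := fun n => Adjunction.ofIsLeftAdjoint (H.functor.flip.obj n)
    refine nonempty_leftRelativeSerreFunctor k H
      (fun n => ((H.functor.flip.obj n).rightAdjoint.obj (𝟙_ A)).unop)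
      (fun n => (adj n).counit.app _) fun m n => ?_
    have hb := ((adj n).homEquiv (op m) (𝟙_ A)).symm.bijective.comp
      (opEquiv (op m) ((H.functor.flip.obj n).rightAdjoint.obj (𝟙_ A))).symm.bijective
    refine Eq.mp (congrArg Function.Bijective (funext fun f => ?_)) hb
    exact (adj n).homEquiv_counit (op m) (𝟙_ A) f.op
  · have h := fun m => H.functor_obj_isLeftAdjoint k hM m
    let adj := fun m => Adjunction.ofIsLeftAdjoint (H.functor.obj (op m))
    refine nonempty_rightRelativeSerreFunctor k H
      (fun m => (H.functor.obj (op m)).rightAdjoint.obj (𝟙_ A))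
      (fun m => (adj m).counit.app _) fun m n => ?_
    have hb := ((adj m).homEquiv n (𝟙_ A)).symm.bijective
    refine Eq.mp (congrArg Function.Bijective (funext fun f => ?_)) hb
    exact (adj m).homEquiv_counit n (𝟙_ A) f

end SerreOfExact

end RelSerre

/-- Let `A` be a finite tensor category over an algebraically closed field `k` and `M` a module
category over `A`. Then `M` has an inner Hom, and for any choice of it, `M` has both a right and a
left relative Serre functor if and only if `M` is an exact module category. -/
theorem proposition4p12
    (k : Type w) [Field k] [IsAlgClosed k]
    (A : Type u₁) [Category.{v₁} A] [Preadditive A] [Linear k A] [MonoidalCategory A]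
    [RigidCategory A] [RelSerre.IsFiniteTensorCategory k A]
    (M : Type u₂) [Category.{v₂} M] [Preadditive M] [Linear k M]
    [MonoidalLeftAction A M] [RelSerre.IsModuleCategory k A M] :
    Nonempty (RelSerre.InnerHom A M) ∧
      ∀ H : RelSerre.InnerHom A M,
        (Nonempty (RelSerre.LeftRelativeSerreFunctor k H) ∧
          Nonempty (RelSerre.RightRelativeSerreFunctor k H)) ↔
        RelSerre.IsExactModuleCategory A M := by
  have : RelSerre.IsFiniteLinearCategory k M := RelSerre.IsModuleCategory.toIsFiniteLinearCategory A
  let _ : Abelian A := RelSerre.abelian k A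
  let _ : Abelian M := RelSerre.abelian k M
  exact ⟨RelSerre.nonempty_innerHom k, fun H =>
    ⟨fun ⟨_, ⟨S⟩⟩ => S.isExactModuleCategory, fun h => h.nonempty_relativeSerreFunctors k H⟩⟩
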